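/- Let $M$ be a connected (Hausdorff, finite-dimensional, boundaryless) smooth manifold with a smooth Riemannian metric $\alpha$ and Levi-Civita connection $\nabla^*$. Let $\beta$ be a smooth one-form on $M$, and let $\beta^\sharp$ be its dual vector field, $\alpha(\beta^\sharp,Y)=\beta(Y)$. The difference tensor of a linear connection $\nabla$ is $A(X,Y)=\nabla_XY-\nabla^*_XY$; its value at $p\in M$ is a bilinear map $A_p\colon T_pM\times T_pM\to T_pM$. For a smooth vector field $X$ and a point $p$, consider the problem at $p$ $$\min\ |\iota_XA|^2\quad\text{subject to}\quad \alpha(A(X,Y),Z)=-\alpha(A(X,Z),Y)\ \text{ for all } Y,Z\in T_pM,\qquad A(X,\beta^\sharp)=-\nabla^*_X\beta^\sharp ,$$ in which $A$ ranges over the bilinear maps $T_pM\times T_pM\to T_pM$ satisfying the constraints at $X_p$. Here $\iota_XA$ is the endomorphism $Y\mapsto A(X,Y)$ of $T_pM$, and $|\cdot|^2$ is the sum of the squares of its components with respect to an $\alpha$-orthonormal basis. The problem is solvable if this minimum is attained. Then the problem is solvable for every smooth vector field $X$ at every point $p$ if and only if $\beta^\sharp$ has constant Riemannian length, that is, $|\beta^\sharp|_\alpha=K$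 on $M$ for some constant $K$. Equivalently, there is one smooth linear connection on $M$ whose difference tensor solves the problem for all smooth vector fields $X$ at all points simultaneously if and only if $\beta^\sharp$ has constant Riemannian length. -/

import Mathlib

open Bundle Manifold
open scoped ContDiff

noncomputable section

namespace RiemannianOpt

section LeviCivita

/-! ### The Levi-Civita connection, built from the Koszul formula -/

variable {E : Type*} [NormedAddCommGroup E] [NormedSpace ℝ E] [FiniteDimensional ℝ E]
  {H : Type*} [TopologicalSpace H] {I : ModelWithCorners ℝ E H}
  {M : Type*} [TopologicalSpace M] [ChartedSpace H M] [IsManifold I ∞ M]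
  [RiemannianBundle (fun x : M ↦ TangentSpace I x)]

/-- The right-hand side of the Koszul formula for `2 α(∇_X Y, Z)` at the point `x`. -/
def koszul (Y X Z : Π x : M, TangentSpace I x) (x : M) : ℝ :=
  d% (fun y ↦ (inner ℝ (Y y) (Z y) : ℝ)) x (X x)
    + d% (fun y ↦ (inner ℝ (X y) (Z y) : ℝ)) x (Y x)
    - d% (fun y ↦ (inner ℝ (X y) (Y y) : ℝ)) x (Z x)
    + inner ℝ (VectorField.mlieBracket I X Y x) (Z x)
    - inner ℝ (VectorField.mlieBracket I X Z x) (Y x)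
    - inner ℝ (VectorField.mlieBracket I Y Z x) (X x)

lemma finiteDimensional_tangentSpace (x : M) : FiniteDimensional ℝ (TangentSpace I x) :=
  inferInstanceAs (FiniteDimensional ℝ E)

lemma completeSpace_tangentSpace (x : M) : CompleteSpace (TangentSpace I x) :=
  have := finiteDimensional_tangentSpace (I := I) x
  FiniteDimensional.complete ℝ _

variable [IsContMDiffRiemannianBundle I ∞ E (fun x : M ↦ TangentSpace I x)]

lemma mdifferentiableAt_inner {X Y : Π x : M, TangentSpace I x} {x : M}
    (hX : MDiffAt (T% X) x) (hY : MDiffAt (T% Y) x) :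
    MDiffAt (fun y ↦ (inner ℝ (X y) (Y y) : ℝ)) x :=
  MDifferentiableAt.inner_bundle (F := E) (E := fun x : M ↦ TangentSpace I x) hX hY

lemma koszul_tensorial_left {Y Z : Π x : M, TangentSpace I x} {x : M}
    (hY : MDiffAt (T% Y) x) (hZ : MDiffAt (T% Z) x) :
    TensorialAt I E (fun X ↦ koszul Y X Z x) x where
  smul {f X} hf hX := by
    have : CompleteSpace E := FiniteDimensional.complete ℝ E
    simp [koszul, inner_smul_left, inner_smul_right,
      mvfderiv_fun_mul hf (mdifferentiableAt_inner hX hY),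
      mvfderiv_fun_mul hf (mdifferentiableAt_inner hX hZ),
      VectorField.mlieBracket_smul_left hf hX, inner_add_left]
    ring
  add {X X'} hX hX' := by
    have : CompleteSpace E := FiniteDimensional.complete ℝ E
    simp [koszul, inner_add_left, inner_add_right,
      mvfderiv_fun_add (mdifferentiableAt_inner hX hY) (mdifferentiableAt_inner hX' hY),
      mvfderiv_fun_add (mdifferentiableAt_inner hX hZ) (mdifferentiableAt_inner hX' hZ),
      VectorField.mlieBracket_add_left hX hX']
    ring

lemma koszul_tensorial_right {Y X : Π x : M, TangentSpace I x} {x : M}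
    (hY : MDiffAt (T% Y) x) (hX : MDiffAt (T% X) x) :
    TensorialAt I E (fun Z ↦ koszul Y X Z x) x where
  smul {f Z} hf hZ := by
    have : CompleteSpace E := FiniteDimensional.complete ℝ E
    simp [koszul, inner_smul_left, inner_smul_right,
      mvfderiv_fun_mul hf (mdifferentiableAt_inner hX hZ),
      mvfderiv_fun_mul hf (mdifferentiableAt_inner hY hZ),
      VectorField.mlieBracket_smul_right hf hZ, inner_add_left]
    rw [real_inner_comm (Z x) (Y x), real_inner_comm (Z x) (X x)]
    ring
  add {Z Z'} hZ hZ' := by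
    have : CompleteSpace E := FiniteDimensional.complete ℝ E
    simp [koszul, inner_add_left, inner_add_right,
      mvfderiv_fun_add (mdifferentiableAt_inner hX hZ) (mdifferentiableAt_inner hX hZ'),
      mvfderiv_fun_add (mdifferentiableAt_inner hY hZ) (mdifferentiableAt_inner hY hZ'),
      VectorField.mlieBracket_add_right hZ hZ']
    ring

open Classical in
/-- `koszul` as a continuous bilinear form in `X x` and `Z x`; it is `0` where `Y` is not
differentiable. -/
def koszulForm (Y : Π x : M, TangentSpace I x) (x : M) :
    TangentSpace I x →L[ℝ] TangentSpace I x →L[ℝ] ℝ :=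
  if hY : MDiffAt (T% Y) x then
    TensorialAt.mkHom₂ (fun X Z ↦ koszul Y X Z x) x
      (fun _ hZ ↦ koszul_tensorial_left hY hZ) (fun _ hX ↦ koszul_tensorial_right hY hX)
  else 0

lemma koszulForm_apply {X Y Z : Π x : M, TangentSpace I x} {x : M}
    (hX : MDiffAt (T% X) x) (hY : MDiffAt (T% Y) x) (hZ : MDiffAt (T% Z) x) :
    koszulForm Y x (X x) (Z x) = koszul Y X Z x := by
  rw [koszulForm, dif_pos hY]
  exact TensorialAt.mkHom₂_apply _ _ hX hZ

/-- The musical isomorphism `♯`: the tangent vector that represents a covector with respect to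
the Riemannian metric. -/
def sharp {x : M} (ξ : TangentSpace I x →L[ℝ] ℝ) : TangentSpace I x :=
  have := completeSpace_tangentSpace (I := I) x
  (InnerProductSpace.toDual ℝ (TangentSpace I x)).symm ξ

lemma inner_sharp {x : M} (ξ : TangentSpace I x →L[ℝ] ℝ) (w : TangentSpace I x) :
    (inner ℝ (sharp ξ) w : ℝ) = ξ w := by
  have := completeSpace_tangentSpace (I := I) x
  simp [sharp]

/-- `v ↦ ∇*_v Y` at the point `x`: the vector that represents half of the Koszul form. -/
def leviCivitaAux (Y : Π x : M, TangentSpace I x) (x : M) :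
    TangentSpace I x →L[ℝ] TangentSpace I x :=
  have := finiteDimensional_tangentSpace (I := I) x
  LinearMap.toContinuousLinearMap
    { toFun := fun v ↦ (2⁻¹ : ℝ) • sharp (koszulForm Y x v)
      map_add' := fun v w ↦ ext_inner_right ℝ fun z ↦ by
        simp [inner_smul_left, inner_add_left, inner_sharp, mul_add]
      map_smul' := fun c v ↦ ext_inner_right ℝ fun z ↦ by
        simp [inner_smul_left, inner_sharp, mul_left_comm] }

lemma inner_leviCivitaAux (Y : Π x : M, TangentSpace I x) (x : M) (v w : TangentSpace I x) :
    (inner ℝ (leviCivitaAux Y x v) w : ℝ) = 2⁻¹ * koszulForm Y x v w := by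
  simp [leviCivitaAux, inner_smul_left, inner_sharp]

lemma inner_leviCivitaAux_apply {X Y Z : Π x : M, TangentSpace I x} {x : M}
    (hX : MDiffAt (T% X) x) (hY : MDiffAt (T% Y) x) (hZ : MDiffAt (T% Z) x) :
    (inner ℝ (leviCivitaAux Y x (X x)) (Z x) : ℝ) = 2⁻¹ * koszul Y X Z x := by
  rw [inner_leviCivitaAux, koszulForm_apply hX hY hZ]

lemma ext_of_inner_sections {x : M} {A B : TangentSpace I x →L[ℝ] TangentSpace I x}
    (h : ∀ X Z : Π x : M, TangentSpace I x, MDiffAt (T% X) x → MDiffAt (T% Z) x →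
      (inner ℝ (A (X x)) (Z x) : ℝ) = inner ℝ (B (X x)) (Z x)) : A = B := by
  ext1 v
  refine ext_inner_right ℝ fun w ↦ ?_
  have := h (FiberBundle.extend E v) (FiberBundle.extend E w)
    (FiberBundle.mdifferentiableAt_extend ..) (FiberBundle.mdifferentiableAt_extend ..)
  simpa using this

lemma leviCivitaAux_isCovariantDerivativeOn :
    IsCovariantDerivativeOn (I := I) (V := fun x : M ↦ TangentSpace I x) E leviCivitaAux
      Set.univ where
  add {Y Y' x} hY hY' _ := by
    have : CompleteSpace E := FiniteDimensional.complete ℝ E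
    refine ext_of_inner_sections fun X Z hX hZ ↦ ?_
    rw [inner_leviCivitaAux_apply hX (mdifferentiableAt_add_section hY hY') hZ]
    simp only [add_apply, inner_add_left]
    rw [inner_leviCivitaAux_apply hX hY hZ, inner_leviCivitaAux_apply hX hY' hZ]
    simp [koszul, inner_add_left, inner_add_right,
      mvfderiv_fun_add (mdifferentiableAt_inner hY hZ) (mdifferentiableAt_inner hY' hZ),
      mvfderiv_fun_add (mdifferentiableAt_inner hX hY) (mdifferentiableAt_inner hX hY'),
      VectorField.mlieBracket_add_left hY hY', VectorField.mlieBracket_add_right hY hY']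
    ring
  leibniz {Y f x} hY hf _ := by
    have : CompleteSpace E := FiniteDimensional.complete ℝ E
    refine ext_of_inner_sections fun X Z hX hZ ↦ ?_
    rw [inner_leviCivitaAux_apply hX (hf.smul_section hY) hZ]
    simp only [add_apply, inner_add_left, smul_apply,
      inner_smul_left]
    rw [inner_leviCivitaAux_apply hX hY hZ]
    simp [koszul, inner_smul_left, inner_smul_right, inner_add_left,
      mvfderiv_fun_mul hf (mdifferentiableAt_inner hY hZ),
      mvfderiv_fun_mul hf (mdifferentiableAt_inner hX hY),
      VectorField.mlieBracket_smul_left hf hY, VectorField.mlieBracket_smul_right hf hY]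
    rw [real_inner_comm (X x) (Y x)]
    ring

variable (I M) in
/-- The Levi-Civita connection `∇*` of the Riemannian metric; `leviCivita I M Y x (X x)` is
`∇*_X Y` at `x`. -/
def leviCivita : CovariantDerivative I E (fun x : M ↦ TangentSpace I x) where
  toFun := leviCivitaAux
  isCovariantDerivativeOnUniv := leviCivitaAux_isCovariantDerivativeOn

lemma leviCivita_isMetricCompatible :
    CovariantDerivative.IsMetricCompatible (V := fun x : M ↦ TangentSpace I x) (F := E)
      (leviCivita I M) := by
  have : CompleteSpace E := FiniteDimensional.complete ℝ E
  rw [CovariantDerivative.isMetricCompatible_iff]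
  intro x X Y Z hX hY hZ
  have h1 : (inner ℝ (leviCivita I M Y x (X x)) (Z x) : ℝ) = 2⁻¹ * koszul Y X Z x :=
    inner_leviCivitaAux_apply hX hY hZ
  have h2 : (inner ℝ (leviCivita I M Z x (X x)) (Y x) : ℝ) = 2⁻¹ * koszul Z X Y x :=
    inner_leviCivitaAux_apply hX hZ hY
  change _ = (inner ℝ (leviCivita I M Y x (X x)) (Z x) : ℝ)
    + inner ℝ (Y x) (leviCivita I M Z x (X x))
  rw [h1, real_inner_comm (leviCivita I M Z x (X x)) (Y x), h2]
  simp only [koszul, real_inner_comm (Y _) (Z _), VectorField.mlieBracket_swap_apply (V := Z) (W := Y), inner_neg_left]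
  ring

lemma leviCivita_torsion [CompleteSpace E] : (leviCivita I M).torsion = 0 := by
  rw [CovariantDerivative.torsion_eq_zero_iff]
  intro X Y x hX hY
  refine ext_inner_right ℝ fun w ↦ ?_
  have hZ : MDiffAt (T% (FiberBundle.extend E w)) x :=
    FiberBundle.mdifferentiableAt_extend (I := I) (F := E) (V := fun x : M ↦ TangentSpace I x) w
  have h1 : (inner ℝ (leviCivita I M Y x (X x)) (FiberBundle.extend E w x) : ℝ)
      = 2⁻¹ * koszul Y X (FiberBundle.extend E w) x :=
    inner_leviCivitaAux_apply hX hY hZ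
  have h2 : (inner ℝ (leviCivita I M X x (Y x)) (FiberBundle.extend E w x) : ℝ)
      = 2⁻¹ * koszul X Y (FiberBundle.extend E w) x :=
    inner_leviCivitaAux_apply hY hX hZ
  rw [inner_sub_left]
  rw [FiberBundle.extend_apply_self] at h1 h2
  rw [h1, h2]
  simp only [koszul, real_inner_comm (X _) (Y _), VectorField.mlieBracket_swap_apply (V := Y) (W := X),
    inner_neg_left, FiberBundle.extend_apply_self]
  ring

end LeviCivita

section Optimization

/-! ### The constrained optimization problem -/

variable {E : Type*} [NormedAddCommGroup E] [NormedSpace ℝ E] [FiniteDimensional ℝ E]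
  {H : Type*} [TopologicalSpace H] {I : ModelWithCorners ℝ E H}
  {M : Type*} [TopologicalSpace M] [ChartedSpace H M] [IsManifold I ∞ M]
  [RiemannianBundle (fun x : M ↦ TangentSpace I x)]

/-- The squared norm of a (1,1) tensor at a point: the sum of the squares of its components with
respect to an orthonormal basis. -/
def tensorNormSq {p : M} (B : TangentSpace I p →L[ℝ] TangentSpace I p) : ℝ :=
  have := finiteDimensional_tangentSpace (I := I) p
  let e := stdOrthonormalBasis ℝ (TangentSpace I p)
  ∑ i, ∑ j, (inner ℝ (e i) (B (e j)) : ℝ) ^ 2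

/-- The squared norm does not depend on the orthonormal basis. -/
lemma tensorNormSq_eq {ι : Type*} [Fintype ι] {p : M}
    (B : TangentSpace I p →L[ℝ] TangentSpace I p)
    (f : OrthonormalBasis ι ℝ (TangentSpace I p)) :
    tensorNormSq B = ∑ i, ∑ j, (inner ℝ (f i) (B (f j)) : ℝ) ^ 2 := by
  have := finiteDimensional_tangentSpace (I := I) p
  have := completeSpace_tangentSpace (I := I) p
  let e := stdOrthonormalBasis ℝ (TangentSpace I p)
  change ∑ i, ∑ j, (inner ℝ (e i) (B (e j)) : ℝ) ^ 2 = _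
  calc ∑ i, ∑ j, (inner ℝ (e i) (B (e j)) : ℝ) ^ 2
      = ∑ j, ∑ i, (inner ℝ (f i) (B (e j)) : ℝ) ^ 2 := by
        rw [Finset.sum_comm]
        exact Finset.sum_congr rfl fun j _ ↦ by rw [e.sum_sq_inner_right, f.sum_sq_inner_right]
    _ = ∑ i, ∑ j, (inner ℝ (f i) (B (f j)) : ℝ) ^ 2 := by
        rw [Finset.sum_comm]
        refine Finset.sum_congr rfl fun i _ ↦ ?_
        simp only [← ContinuousLinearMap.adjoint_inner_left]
        rw [e.sum_sq_inner_left, f.sum_sq_inner_left]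

variable [IsContMDiffRiemannianBundle I ∞ E (fun x : M ↦ TangentSpace I x)]

/-- The difference tensor `A(X, Y) = ∇_X Y - ∇*_X Y` of a linear connection at the point `p`, where
`∇*` is the Levi-Civita connection. -/
def differenceTensor (nabla : CovariantDerivative I E (fun x : M ↦ TangentSpace I x)) (p : M) :
    TangentSpace I p →L[ℝ] TangentSpace I p →L[ℝ] TangentSpace I p :=
  (nabla.difference (leviCivita I M) p).flip

lemma differenceTensor_apply
    (nabla : CovariantDerivative I E (fun x : M ↦ TangentSpace I x)) {p : M}
    (v : TangentSpace I p) {Y : Π x : M, TangentSpace I x} (hY : MDiffAt (T% Y) p) :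
    differenceTensor nabla p v (Y p) = nabla Y p v - leviCivita I M Y p v := by
  have := IsCovariantDerivativeOn.difference_apply nabla.isCovariantDerivativeOnUniv
    (leviCivita I M).isCovariantDerivativeOnUniv (Set.mem_univ p) hY
  exact congr($this v)

/-- The constraints of the optimization problem at the point `p`, for the value `v` of the vector
field `X` at `p`: the map `A(v, ·)` is skew-symmetric, and `A(v, β♯) = -∇*_v β♯`. -/
structure SatisfiesConstraints (β : Π x : M, TangentSpace I x →L[ℝ] ℝ) (p : M)
    (v : TangentSpace I p)
    (A : TangentSpace I p →L[ℝ] TangentSpace I p →L[ℝ] TangentSpace I p) : Prop where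
  skew : ∀ y z : TangentSpace I p, (inner ℝ (A v y) z : ℝ) = -inner ℝ (A v z) y
  apply_sharp : A v (sharp (β p)) = -leviCivita I M (fun x ↦ sharp (β x)) p v

/-- `A` solves, at the point `p` and for the value `v` of the vector field at `p`, the problem of
minimizing `|ι_v A|²` subject to the constraints. -/
def IsSolutionAt (β : Π x : M, TangentSpace I x →L[ℝ] ℝ) (p : M) (v : TangentSpace I p)
    (A : TangentSpace I p →L[ℝ] TangentSpace I p →L[ℝ] TangentSpace I p) : Prop :=
  SatisfiesConstraints β p v A ∧
    ∀ A' : TangentSpace I p →L[ℝ] TangentSpace I p →L[ℝ] TangentSpace I p,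
      SatisfiesConstraints β p v A' → tensorNormSq (A v) ≤ tensorNormSq (A' v)

end Optimization

end RiemannianOpt

end

/-! Write `u = β♯` and `w = ∇*_v β♯`. Only the value `v` of `X` at the point enters the problem.
Skewness with both arguments equal to `u` gives `⟨A(v, u), u⟩ = 0`, so a feasible `A` forces `⟨w, u⟩
= 0`. By metric compatibility this is half the derivative of `|u|²` along `v`
(`mvfderiv_inner_self`); if it vanishes for all `v`, connectedness makes `|u|` constant.

Conversely, constant length gives `w ⊥ u`, and the skew operator `skewRankTwo u w` sends `u` to
`-w`. A competitor differs from it by a skew operator `C` with `C u = 0`, which is Hilbert–Schmidt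
orthogonal to it (`sum_inner_skewRankTwo`), so Pythagoras gives minimality. The minimizer is linear
in `w`, hence in `v`: a single tensor serves all vector fields. Its smoothness reduces to that of
`∇*`, read off from the Koszul formula. For length `0` everything vanishes. -/

noncomputable section

namespace RiemannianOpt

/-! ### Smoothness of bundle maps and sections, tested on local extensions of vectors -/

section SmoothnessCriteria

open ContinuousLinearMap Topology

variable {EB : Type*} [NormedAddCommGroup EB] [NormedSpace ℝ EB]
  {HB : Type*} [TopologicalSpace HB] {IB : ModelWithCorners ℝ EB HB} {n : ℕ∞ω}
  {B : Type*} [TopologicalSpace B] [ChartedSpace HB B]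

/-- A family of continuous linear maps on a finite-dimensional space is `C^n` as soon as its value
at each vector is. -/
lemma contMDiffAt_clm_of_apply {F F' : Type*} [NormedAddCommGroup F] [NormedSpace ℝ F]
    [FiniteDimensional ℝ F] [NormedAddCommGroup F'] [NormedSpace ℝ F'] {f : B → F →L[ℝ] F'}
    {x₀ : B} (h : ∀ v, CMDiffAt n (fun x ↦ f x v) x₀) : CMDiffAt n f x₀ := by
  let b := Module.finBasis ℝ F
  let c (i) : F →L[ℝ] ℝ := LinearMap.toContinuousLinearMap (b.coord i)
  -- Expansion in the dual basis: each summand is a fixed continuous linear map applied to `f x (b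
  -- i)`.
  have hf : f = fun x ↦ ∑ i, smulRightL ℝ F F' (c i) (f x (b i)) := by
    ext x v
    simp only [sum_apply, smulRightL_apply_apply]
    conv_lhs => rw [← b.sum_repr v]
    simp only [map_sum, map_smul]
    rfl
  rw [hf]
  exact ContMDiffAt.sum fun i _ ↦ (smulRightL ℝ F F' (c i)).contMDiff.contMDiffAt.comp x₀ (h (b i))

variable {F : Type*} [NormedAddCommGroup F] [NormedSpace ℝ F] [FiniteDimensional ℝ F]

/-- A family of continuous linear maps between the fibers of two bundles is `C^n` at `x₀` as soon
as it maps the local extensions of the vectors at `x₀` to `C^n` sections. -/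
lemma contMDiffAt_hom_of_apply_extend {V : B → Type*} [TopologicalSpace (TotalSpace F V)]
    [∀ x, AddCommGroup (V x)] [∀ x, Module ℝ (V x)] [∀ x, TopologicalSpace (V x)]
    [FiberBundle F V] [VectorBundle ℝ F V]
    {F' : Type*} [NormedAddCommGroup F'] [NormedSpace ℝ F'] {W : B → Type*}
    [TopologicalSpace (TotalSpace F' W)] [∀ x, AddCommGroup (W x)] [∀ x, Module ℝ (W x)]
    [∀ x, TopologicalSpace (W x)] [∀ x, IsTopologicalAddGroup (W x)] [∀ x, ContinuousSMul ℝ (W x)]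
    [FiberBundle F' W] [VectorBundle ℝ F' W] {φ : Π x, V x →L[ℝ] W x} {x₀ : B}
    (h : ∀ v : V x₀, CMDiffAt n (T% (fun x ↦ φ x (FiberBundle.extend F v x))) x₀) :
    ContMDiffAt IB (IB.prod 𝓘(ℝ, F →L[ℝ] F')) n
      (fun x ↦ TotalSpace.mk' (F →L[ℝ] F') (E := fun x ↦ V x →L[ℝ] W x) x (φ x)) x₀ := by
  rw [contMDiffAt_hom_bundle]
  refine ⟨contMDiffAt_id, contMDiffAt_clm_of_apply fun w ↦ ?_⟩
  have hx₀ := FiberBundle.mem_baseSet_trivializationAt' (F := F) (E := V) x₀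
  have hx₀' := FiberBundle.mem_baseSet_trivializationAt' (F := F') (E := W) x₀
  have := h ((trivializationAt F V x₀).symm x₀ w)
  rw [contMDiffAt_section] at this
  -- `FiberBundle.extend` has constant coordinates in the trivialization at `x₀`, so both sides are
  -- the coordinates of `φ x` applied to the fixed vector `w`.
  refine this.congr_of_eventuallyEq ?_
  filter_upwards [(trivializationAt F V x₀).open_baseSet.mem_nhds hx₀,
    (trivializationAt F' W x₀).open_baseSet.mem_nhds hx₀'] with x hx hx'
  rw [inCoordinates_eq hx hx']
  simp [FiberBundle.extend, hx₀]

/-- A section of a Riemannian bundle is `C^n` at `x₀` as soon as its inner products with the local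
extensions of the vectors at `x₀` are. -/
lemma contMDiffAt_section_of_inner_extend {V : B → Type*} [TopologicalSpace (TotalSpace F V)]
    [∀ x, NormedAddCommGroup (V x)] [∀ x, InnerProductSpace ℝ (V x)]
    [FiberBundle F V] [VectorBundle ℝ F V] [h : IsContMDiffRiemannianBundle IB n F V]
    {s : Π x, V x} {x₀ : B}
    (hs : ∀ v : V x₀, CMDiffAt n (fun x ↦ (inner ℝ (s x) (FiberBundle.extend F v x) : ℝ)) x₀) :
    CMDiffAt n (T% s) x₀ := by
  obtain ⟨g, hg, hg'⟩ := h.exists_contMDiff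
  have hx₀ := FiberBundle.mem_baseSet_trivializationAt' (F := F) (E := V) x₀
  let e := trivializationAt F V x₀
  have hG := ((contMDiffAt_hom_bundle _).1 (hg x₀)).2
  -- The metric in coordinates. It is injective by positive definiteness, hence invertible by
  -- dimension, and the coordinates of `s` are recovered as `G⁻¹ ξ`, where `ξ` is known from the
  -- inner products.
  let G : B → F →L[ℝ] F →L[ℝ] ℝ := fun x ↦
    inCoordinates F V (F →L[ℝ] ℝ) (fun x ↦ V x →L[ℝ] ℝ) x₀ x x₀ x (g x)
  have hGapply {x : B} (hx : x ∈ e.baseSet) (u w : F) :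
      G x u w = inner ℝ (e.symm x u) (e.symm x w) := by
    have hx' : x ∈ (trivializationAt (F →L[ℝ] ℝ) (fun x ↦ V x →L[ℝ] ℝ) x₀).baseSet := by
      simpa [hom_trivializationAt_baseSet] using hx
    rw [hg' x]
    simp only [G]
    rw [inCoordinates_eq hx hx']
    simp [hom_trivializationAt_apply]
    rw [inCoordinates_eq hx (by simp)]
    simp [e]
  have hGinv {x : B} (hx : x ∈ e.baseSet) : (G x).IsInvertible := by
    have hinj : Function.Injective (G x) := by
      rw [injective_iff_map_eq_zero]
      intro u hu
      have h0 : (inner ℝ (e.symm x u) (e.symm x u) : ℝ) = 0 := by rw [← hGapply hx, hu]; rfl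
      rw [inner_self_eq_zero] at h0
      rw [← e.continuousLinearMapAt_symmL (R := ℝ) hx u, e.symmL_apply hx, h0, map_zero]
    refine ⟨(LinearEquiv.ofInjectiveOfFinrankEq (G x : F →ₗ[ℝ] F →L[ℝ] ℝ) hinj ?_).toContinuousLinearEquiv, ?_⟩
    · rw [← LinearMap.toContinuousLinearMap.finrank_eq]
      exact (Subspace.dual_finrank_eq (K := ℝ) (V := F)).symm
    · ext1 v; rfl
  let ξ : B → F →L[ℝ] ℝ := fun x ↦ G x (e ⟨x, s x⟩).2
  have hξ : CMDiffAt n ξ x₀ := by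
    refine contMDiffAt_clm_of_apply fun w ↦ ?_
    refine (hs (e.symm x₀ w)).congr_of_eventuallyEq ?_
    filter_upwards [e.open_baseSet.mem_nhds hx₀] with x hx
    simp [ξ, hGapply hx, FiberBundle.extend, e, hx₀, hx]
  rw [contMDiffAt_section]
  have : CMDiffAt n (fun x ↦ (G x).inverse (ξ x)) x₀ := by
    refine ContMDiffAt.clm_apply ?_ hξ
    exact (hGinv hx₀).contDiffAt_map_inverse.contMDiffAt.comp x₀ hG
  refine this.congr_of_eventuallyEq ?_
  filter_upwards [e.open_baseSet.mem_nhds hx₀] with x hx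
  simp [ξ, (hGinv hx).inverse_apply_self, e]

end SmoothnessCriteria

/-! ### Smoothness of the Levi-Civita derivative and of the dual vector field -/

section Smoothness

open Topology

variable {E : Type*} [NormedAddCommGroup E] [NormedSpace ℝ E]
  {H : Type*} [TopologicalSpace H] {I : ModelWithCorners ℝ E H}
  {M : Type*} [TopologicalSpace M] [ChartedSpace H M] [IsManifold I ∞ M]

/-- The derivative of a smooth function along a smooth vector field is smooth. -/
lemma contMDiffAt_mvfderiv_apply {f : M → ℝ} {X : Π x : M, TangentSpace I x} {x₀ : M}
    (hf : CMDiffAt ∞ f x₀) (hX : CMDiffAt ∞ (T% X) x₀) :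
    CMDiffAt ∞ (fun x ↦ d% f x (X x)) x₀ := by
  have h := ContMDiffAt.clm_apply_of_inCoordinates (F₁ := E) (F₂ := ℝ) (E₁ := TangentSpace I)
    (E₂ := TangentSpace 𝓘(ℝ, ℝ)) (b₁ := id) (b₂ := f) (ϕ := fun x ↦ mfderiv% f x) (v := X)
    (hf.mfderiv_const (m := ∞) le_rfl) hX hf
  rw [contMDiffAt_totalSpace] at h
  simp only [trivializationAt_model_space_apply] at h
  exact h.2

lemma eventually_mdifferentiableAt {X : Π x : M, TangentSpace I x} {x₀ : M}
    (hX : CMDiffAt ∞ (T% X) x₀) : ∀ᶠ x in 𝓝 x₀, MDiffAt (T% X) x := by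
  -- Regularity at a point spreads to a neighbourhood for finite order, so order `1` is used.
  have h1 : CMDiffAt 1 (T% X) x₀ := hX.of_le (by simp)
  rw [contMDiffAt_iff_contMDiffAt_nhds (by simp)] at h1
  filter_upwards [h1] with x hx
  exact hx.mdifferentiableAt one_ne_zero

lemma contMDiffAt_extend (x₀ : M) (v : TangentSpace I x₀) :
    CMDiffAt ∞ (T% (FiberBundle.extend E v)) x₀ :=
  FiberBundle.contMDiffAt_extend I E v

lemma contMDiffAt_mlieBracket [FiniteDimensional ℝ E] {X Y : Π x : M, TangentSpace I x} {x₀ : M}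
    (hX : CMDiffAt ∞ (T% X) x₀) (hY : CMDiffAt ∞ (T% Y) x₀) :
    CMDiffAt ∞ (T% (VectorField.mlieBracket I X Y)) x₀ := by
  have : CompleteSpace E := FiniteDimensional.complete ℝ E
  have : IsManifold I (((⊤ : ℕ∞) : ℕ∞ω) + 1) M := inferInstanceAs (IsManifold I ∞ M)
  have : IsManifold I (minSmoothness ℝ 2) M := by
    rw [minSmoothness_of_isRCLikeNormedField]; infer_instance
  exact ContMDiffAt.mlieBracket_vectorField (m := ⊤) (n := ⊤) hX hY (by simp)

variable [RiemannianBundle (fun x : M ↦ TangentSpace I x)]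
  [IsContMDiffRiemannianBundle I ∞ E (fun x : M ↦ TangentSpace I x)]

lemma contMDiffAt_inner {X Y : Π x : M, TangentSpace I x} {x₀ : M}
    (hX : CMDiffAt ∞ (T% X) x₀) (hY : CMDiffAt ∞ (T% Y) x₀) :
    CMDiffAt ∞ (fun x ↦ (inner ℝ (X x) (Y x) : ℝ)) x₀ :=
  ContMDiffAt.inner_bundle (F := E) (E := fun x : M ↦ TangentSpace I x) hX hY

variable [FiniteDimensional ℝ E]

lemma contMDiffAt_koszul {X Y Z : Π x : M, TangentSpace I x} {x₀ : M}
    (hX : CMDiffAt ∞ (T% X) x₀) (hY : CMDiffAt ∞ (T% Y) x₀) (hZ : CMDiffAt ∞ (T% Z) x₀) :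
    CMDiffAt ∞ (koszul Y X Z) x₀ :=
  (((((contMDiffAt_mvfderiv_apply (contMDiffAt_inner hY hZ) hX).add
    (contMDiffAt_mvfderiv_apply (contMDiffAt_inner hX hZ) hY)).sub
    (contMDiffAt_mvfderiv_apply (contMDiffAt_inner hX hY) hZ)).add
    (contMDiffAt_inner (contMDiffAt_mlieBracket hX hY) hZ)).sub
    (contMDiffAt_inner (contMDiffAt_mlieBracket hX hZ) hY)).sub
    (contMDiffAt_inner (contMDiffAt_mlieBracket hY hZ) hX)

/-- The Levi-Civita derivative of a smooth vector field is a smooth section of the endomorphism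
bundle. -/
lemma contMDiffAt_leviCivitaAux {Y : Π x : M, TangentSpace I x} {x₀ : M}
    (hY : CMDiffAt ∞ (T% Y) x₀) :
    ContMDiffAt I (I.prod 𝓘(ℝ, E →L[ℝ] E)) ∞
      (fun x ↦ TotalSpace.mk' (E →L[ℝ] E)
        (E := fun x : M ↦ TangentSpace I x →L[ℝ] TangentSpace I x) x (leviCivitaAux Y x)) x₀ := by
  refine contMDiffAt_hom_of_apply_extend fun v ↦ ?_
  refine contMDiffAt_section_of_inner_extend (V := fun x : M ↦ TangentSpace I x) fun w ↦ ?_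
  refine ((contMDiffAt_const (c := (2⁻¹ : ℝ))).mul (contMDiffAt_koszul
    (contMDiffAt_extend x₀ v) hY (contMDiffAt_extend x₀ w))).congr_of_eventuallyEq ?_
  filter_upwards [eventually_mdifferentiableAt hY,
    eventually_mdifferentiableAt (contMDiffAt_extend x₀ v),
    eventually_mdifferentiableAt (contMDiffAt_extend x₀ w)] with x hY hv hw
  exact inner_leviCivitaAux_apply hv hY hw

/-- The vector field dual to a smooth one-form is smooth. -/
lemma contMDiffAt_sharp {β : Π x : M, TangentSpace I x →L[ℝ] ℝ} {x₀ : M}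
    (hβ : ContMDiffAt I (I.prod 𝓘(ℝ, E →L[ℝ] ℝ)) ∞
      (fun x : M ↦ TotalSpace.mk' (E →L[ℝ] ℝ)
        (E := fun x : M ↦ (TangentSpace I x →L[ℝ] ℝ)) x (β x)) x₀) :
    CMDiffAt ∞ (T% (fun x ↦ sharp (β x))) x₀ := by
  refine contMDiffAt_section_of_inner_extend (V := fun x : M ↦ TangentSpace I x) fun w ↦ ?_
  simp only [inner_sharp]
  have h : ContMDiffAt I (I.prod 𝓘(ℝ, ℝ)) ∞ (fun x ↦ TotalSpace.mk' ℝ (E := Bundle.Trivial M ℝ) x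
      (β x (FiberBundle.extend E w x))) x₀ :=
    ContMDiffAt.clm_bundle_apply (F₁ := E) hβ (contMDiffAt_extend x₀ w)
  rw [contMDiffAt_totalSpace] at h
  exact h.2

end Smoothness

/-! ### Functions with zero derivative, and global fields with a prescribed value -/

section Manifold

open Topology

variable {E : Type*} [NormedAddCommGroup E] [NormedSpace ℝ E]
  {M : Type*} [TopologicalSpace M] [ChartedSpace E M] [IsManifold 𝓘(ℝ, E) ∞ M]

/-- A differentiable function with vanishing derivative on a connected boundaryless manifold is
constant. -/
lemma eq_of_mvfderiv_eq_zero [ConnectedSpace M] {f : M → ℝ} (hf : MDiff f)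
    (h : ∀ x, d% f x = 0) (x y : M) : f x = f y := by
  refine IsLocallyConstant.apply_eq_of_preconnectedSpace ?_ x y
  rw [IsLocallyConstant.iff_eventually_eq]
  intro x
  let e := extChartAt 𝓘(ℝ, E) x
  have htarget : IsOpen e.target := isOpen_extChartAt_target x
  have hd : ∀ z ∈ e.target, HasFDerivAt (f ∘ e.symm) (0 : E →L[ℝ] ℝ) z := by
    intro z hz
    have h1 : MDiffAt e.symm z :=
      ((contMDiffOn_extChartAt_symm (n := ∞) x).contMDiffAt (htarget.mem_nhds hz)).mdifferentiableAt
        (by simp)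
    have h2 := (hf (e.symm z)).hasMFDerivAt.comp z h1.hasMFDerivAt
    have h3 : mfderiv% f (e.symm z) = 0 := h (e.symm z)
    rw [h3, ContinuousLinearMap.zero_comp] at h2
    exact h2.hasFDerivAt
  -- Level sets are open in the chart target, so the target need not be convex or connected.
  have ho := htarget.isOpen_inter_preimage_of_fderiv_eq_zero (f := f ∘ e.symm)
    (fun z hz ↦ (hd z hz).differentiableAt.differentiableWithinAt) (fun z hz ↦ (hd z hz).fderiv)
    {f x}
  have hmem : e x ∈ e.target ∩ (f ∘ e.symm) ⁻¹' {f x} :=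
    ⟨mem_extChartAt_target x, by simp [e]⟩
  filter_upwards [(continuousAt_extChartAt (I := 𝓘(ℝ, E)) x).preimage_mem_nhds (ho.mem_nhds hmem),
    extChartAt_source_mem_nhds (I := 𝓘(ℝ, E)) x] with y hy hys
  have h := hy.2
  rwa [Set.mem_preimage, Function.comp_apply, e.left_inv hys] at h

/-- Every tangent vector is the value of a global smooth vector field. -/
lemma exists_contMDiff_apply_eq [FiniteDimensional ℝ E] [T2Space M] (p : M)
    (v : TangentSpace 𝓘(ℝ, E) p) :
    ∃ X : Π x : M, TangentSpace 𝓘(ℝ, E) x, CMDiff ∞ (T% X) ∧ X p = v := by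
  obtain ⟨s, hs, hX⟩ := FiberBundle.exists_contMDiffOn_extend (k := ∞) 𝓘(ℝ, E) E v
  obtain ⟨u, hus, hu, hpu⟩ := mem_nhds_iff.1 hs
  obtain ⟨f, -, hf⟩ := (SmoothBumpFunction.nhds_basis_tsupport (I := 𝓘(ℝ, E)) p).mem_iff.1
    (hu.mem_nhds hpu)
  refine ⟨fun x ↦ f x • FiberBundle.extend E v x, ?_, by simp⟩
  exact ContMDiffOn.smul_section_of_tsupport f.contMDiff.contMDiffOn hu hf (hX.mono hus)

end Manifold

/-! ### Skew operators with a prescribed value at one vector -/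

section Algebra

variable {V : Type*} [NormedAddCommGroup V] [InnerProductSpace ℝ V]

/-- For `w` orthogonal to `u`, the skew-symmetric rank-two operator
`y ↦ |u|⁻² (⟨w, y⟩ u - ⟨u, y⟩ w)`, which maps `u` to `-w`; it is linear in `w`. -/
def skewRankTwo (u : V) : V →L[ℝ] V →L[ℝ] V :=
  (‖u‖ ^ 2)⁻¹ • (((ContinuousLinearMap.smulRightL ℝ V V).flip u).comp (show V →L[ℝ] V →L[ℝ] ℝ from innerSL ℝ)
    - ContinuousLinearMap.smulRightL ℝ V V (innerSL ℝ u))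

lemma skewRankTwo_apply (u w y : V) :
    skewRankTwo u w y = (‖u‖ ^ 2)⁻¹ • ((inner ℝ w y : ℝ) • u - (inner ℝ u y : ℝ) • w) := by
  simp only [skewRankTwo, smul_apply, sub_apply, ContinuousLinearMap.comp_apply,
    ContinuousLinearMap.flip_apply, ContinuousLinearMap.smulRightL_apply_apply]
  rfl

lemma inner_skewRankTwo (u w y z : V) :
    (inner ℝ (skewRankTwo u w y) z : ℝ) = -inner ℝ (skewRankTwo u w z) y := by
  simp only [skewRankTwo_apply, inner_smul_left, inner_sub_left]
  simp
  ring

/-- At `u = 0` the operator sends `u` to `0`, so the identity needs `w = 0`; this is the role of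
`hu`. -/
lemma skewRankTwo_self {u w : V} (h : inner ℝ w u = (0 : ℝ)) (hu : u = 0 → w = 0) :
    skewRankTwo u w u = -w := by
  by_cases hu0 : u = 0
  · simp [hu hu0]
  · have : ‖u‖ ^ 2 ≠ 0 := by simpa using hu0
    rw [skewRankTwo_apply, h, real_inner_self_eq_norm_sq, zero_smul, zero_sub, smul_neg,
      smul_smul, inv_mul_cancel₀ this, one_smul]

/-- `skewRankTwo u w` is orthogonal to the skew-symmetric operators that vanish at `u`. -/
lemma sum_inner_skewRankTwo {ι : Type*} [Fintype ι] (e : OrthonormalBasis ι ℝ V) (u w : V)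
    {C : V →L[ℝ] V} (hC : ∀ y z, (inner ℝ (C y) z : ℝ) = -inner ℝ (C z) y) (hCu : C u = 0) :
    ∑ j, (inner ℝ (skewRankTwo u w (e j)) (C (e j)) : ℝ) = 0 := by
  -- By skewness, `C u = 0` puts the range of `C` in the orthogonal complement of `u`.
  have h1 (y : V) : (inner ℝ u (C y) : ℝ) = 0 := by
    rw [real_inner_comm, hC, hCu, inner_zero_left, neg_zero]
  -- Moving `C` to the other side and applying Parseval turns the sum into `-⟨u, C w⟩`.
  have h2 : ∑ j, (inner ℝ u (e j) : ℝ) * inner ℝ w (C (e j)) = 0 := by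
    have (j : ι) : (inner ℝ w (C (e j)) : ℝ) = -inner ℝ (e j) (C w) := by
      rw [real_inner_comm, hC, real_inner_comm]
    simp only [this, mul_neg, Finset.sum_neg_distrib, e.sum_inner_mul_inner, h1, neg_zero]
  simp only [skewRankTwo_apply, inner_smul_left, inner_sub_left, h1, mul_zero, zero_sub]
  simp [← Finset.mul_sum, h2]

end Algebra

/-! ### Feasibility, minimality and the optimal connection -/

section Optimization

variable {E : Type*} [NormedAddCommGroup E] [NormedSpace ℝ E] [FiniteDimensional ℝ E]
  {H : Type*} [TopologicalSpace H] {I : ModelWithCorners ℝ E H}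
  {M : Type*} [TopologicalSpace M] [ChartedSpace H M] [IsManifold I ∞ M]
  [RiemannianBundle (fun x : M ↦ TangentSpace I x)]

lemma tensorNormSq_eq_sum_norm {p : M} (B : TangentSpace I p →L[ℝ] TangentSpace I p)
    {ι : Type*} [Fintype ι] (e : OrthonormalBasis ι ℝ (TangentSpace I p)) :
    tensorNormSq B = ∑ j, ‖B (e j)‖ ^ 2 := by
  rw [tensorNormSq_eq B e, Finset.sum_comm]
  exact Finset.sum_congr rfl fun j _ ↦ e.sum_sq_inner_right _

/-- `skewRankTwo u w` has the least norm among the skew-symmetric operators with the same value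
at `u`. -/
lemma tensorNormSq_skewRankTwo_le {p : M} (u w : TangentSpace I p)
    {B : TangentSpace I p →L[ℝ] TangentSpace I p}
    (hB : ∀ y z, (inner ℝ (B y) z : ℝ) = -inner ℝ (B z) y) (hBu : B u = skewRankTwo u w u) :
    tensorNormSq (skewRankTwo u w) ≤ tensorNormSq B := by
  have := finiteDimensional_tangentSpace (I := I) p
  let e := stdOrthonormalBasis ℝ (TangentSpace I p)
  have h := sum_inner_skewRankTwo e u w (C := B - skewRankTwo u w)
    (fun y z ↦ by
      simp only [sub_apply, inner_sub_left]
      rw [hB, inner_skewRankTwo]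
      ring)
    (by simp [hBu])
  rw [tensorNormSq_eq_sum_norm _ e, tensorNormSq_eq_sum_norm _ e, ← sub_nonneg,
    ← Finset.sum_sub_distrib]
  -- Pythagoras: the cross terms cancel only after summation over `j`, by `h`.
  have key (j) : ‖B (e j)‖ ^ 2 - ‖skewRankTwo u w (e j)‖ ^ 2 =
      2 * inner ℝ (skewRankTwo u w (e j)) ((B - skewRankTwo u w) (e j))
        + ‖(B - skewRankTwo u w) (e j)‖ ^ 2 := by
    have := norm_add_sq_real (skewRankTwo u w (e j)) ((B - skewRankTwo u w) (e j))
    rw [sub_apply, add_sub_cancel] at this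
    rw [this, sub_apply]
    ring
  simp only [key, Finset.sum_add_distrib, ← Finset.mul_sum, h, mul_zero, zero_add]
  positivity

variable [IsContMDiffRiemannianBundle I ∞ E (fun x : M ↦ TangentSpace I x)]

lemma mvfderiv_inner_self {Y : Π x : M, TangentSpace I x} {p : M} (hY : MDiffAt (T% Y) p)
    (v : TangentSpace I p) :
    d% (fun x ↦ (inner ℝ (Y x) (Y x) : ℝ)) p v = 2 * inner ℝ (leviCivita I M Y p v) (Y p) := by
  have h := leviCivita_isMetricCompatible (I := I) (M := M) |>.mvfderiv_inner_eq
    (FiberBundle.extend E v) hY hY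
  simp only [FiberBundle.extend_apply_self] at h
  rw [h, real_inner_comm]
  ring

/-- The obstruction to feasibility: a skew operator sends `β♯` to a vector orthogonal to `β♯`. -/
lemma SatisfiesConstraints.inner_leviCivita_eq_zero {β : Π x : M, TangentSpace I x →L[ℝ] ℝ}
    {p : M} {v : TangentSpace I p}
    {A : TangentSpace I p →L[ℝ] TangentSpace I p →L[ℝ] TangentSpace I p}
    (h : SatisfiesConstraints β p v A) :
    (inner ℝ (leviCivita I M (fun x ↦ sharp (β x)) p v) (sharp (β p)) : ℝ) = 0 := by
  have h1 := h.skew (sharp (β p)) (sharp (β p))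
  rw [h.apply_sharp, inner_neg_left] at h1
  linarith

/-- If the length of `β♯` is constant, `∇*_v β♯` is orthogonal to `β♯`. -/
lemma inner_leviCivita_eq_zero_of_norm_eq {Y : Π x : M, TangentSpace I x} {K : ℝ}
    (hK : ∀ x, ‖Y x‖ = K) {p : M} (hY : MDiffAt (T% Y) p) (v : TangentSpace I p) :
    (inner ℝ (leviCivita I M Y p v) (Y p) : ℝ) = 0 := by
  have h := mvfderiv_inner_self hY v
  simp only [real_inner_self_eq_norm_sq, hK, mvfderiv_const] at h
  simpa using h.symm

/-- The difference tensor `A(v, y) = |β♯|⁻² (⟨∇*_v β♯, y⟩ β♯ - ⟨β♯, y⟩ ∇*_v β♯)`. -/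
def optimalTensor (Y : Π x : M, TangentSpace I x) (p : M) :
    TangentSpace I p →L[ℝ] TangentSpace I p →L[ℝ] TangentSpace I p :=
  (skewRankTwo (Y p)).comp (leviCivita I M Y p)

lemma optimalTensor_apply_self {Y : Π x : M, TangentSpace I x} {K : ℝ} (hK : ∀ x, ‖Y x‖ = K)
    {p : M} (hY : MDiffAt (T% Y) p) (v : TangentSpace I p) :
    optimalTensor Y p v (Y p) = -leviCivita I M Y p v := by
  -- One zero of `Y` forces `K = 0`, hence `Y = 0` everywhere.
  have h0 (h : Y p = 0) : leviCivita I M Y p v = 0 := by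
    have hzero : Y = 0 := by
      funext x
      rw [Pi.zero_apply, ← norm_eq_zero, hK x, ← hK p, h, norm_zero]
    rw [hzero, (leviCivita I M).zero]
    rfl
  rw [optimalTensor, ContinuousLinearMap.comp_apply]
  exact skewRankTwo_self (inner_leviCivita_eq_zero_of_norm_eq hK hY v) h0

lemma isSolutionAt_optimalTensor {β : Π x : M, TangentSpace I x →L[ℝ] ℝ} {K : ℝ}
    (hK : ∀ x, ‖sharp (β x)‖ = K) {p : M} (hβ : MDiffAt (T% (fun x ↦ sharp (β x))) p)
    (v : TangentSpace I p) :
    IsSolutionAt β p v (optimalTensor (fun x ↦ sharp (β x)) p) := by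
  have hsharp := optimalTensor_apply_self hK hβ v
  refine ⟨⟨fun y z ↦ inner_skewRankTwo (sharp (β p)) _ y z, hsharp⟩, fun A' hA' ↦ ?_⟩
  exact tensorNormSq_skewRankTwo_le (sharp (β p)) _ hA'.skew
    (hA'.apply_sharp.trans hsharp.symm)

/-- The connection whose difference tensor is `optimalTensor Y`. -/
def optimalConnection (Y : Π x : M, TangentSpace I x) :
    CovariantDerivative I E (fun x : M ↦ TangentSpace I x) :=
  (leviCivita I M).addOneForm fun x ↦ (optimalTensor Y x).flip

lemma differenceTensor_optimalConnection (Y : Π x : M, TangentSpace I x) (p : M) :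
    differenceTensor (optimalConnection Y) p = optimalTensor Y p := by
  ext v y
  have h := differenceTensor_apply (optimalConnection Y) v
    (FiberBundle.mdifferentiableAt_extend I E y)
  rw [FiberBundle.extend_apply_self] at h
  rw [h]
  simp [optimalConnection, CovariantDerivative.addOneForm]

lemma contMDiffCovariantDerivative_optimalConnection {Y : Π x : M, TangentSpace I x}
    (hY : CMDiff ∞ (T% Y)) {K : ℝ} (hK : ∀ x, ‖Y x‖ = K) :
    (optimalConnection Y).ContMDiffCovariantDerivative ∞ := by
  refine ⟨⟨fun {σ} hσ x₀ _ ↦ ContMDiffAt.contMDiffWithinAt ?_⟩⟩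
  have hσ : CMDiffAt ∞ (T% σ) x₀ := hσ.contMDiffAt Filter.univ_mem
  refine contMDiffAt_hom_of_apply_extend fun v ↦ ?_
  have hv := contMDiffAt_extend x₀ v
  have h1 : CMDiffAt ∞ (T% (fun x ↦ leviCivitaAux σ x (FiberBundle.extend E v x))) x₀ :=
    (contMDiffAt_leviCivitaAux hσ).clm_bundle_apply hv
  have h2 : CMDiffAt ∞ (T% (fun x ↦ leviCivitaAux Y x (FiberBundle.extend E v x))) x₀ :=
    (contMDiffAt_leviCivitaAux (hY x₀)).clm_bundle_apply hv
  -- Since `|Y| = K`, the factor `(‖Y x‖ ^ 2)⁻¹` is the constant `(K ^ 2)⁻¹`; this covers `K = 0`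
  -- too, as `0⁻¹ = 0`.
  have h3 := h1.add_section (((contMDiffAt_inner h2 hσ).smul_section (hY x₀)).sub_section
    ((contMDiffAt_inner (hY x₀) hσ).smul_section h2) |>.const_smul_section (a := (K ^ 2)⁻¹))
  refine h3.congr_of_eventuallyEq (Filter.Eventually.of_forall fun x ↦ ?_)
  simp [optimalConnection, CovariantDerivative.addOneForm, optimalTensor, skewRankTwo_apply, hK x]
  rfl

end Optimization

end RiemannianOpt

end

theorem mainTheorem1 {E : Type*} [NormedAddCommGroup E] [NormedSpace ℝ E] [FiniteDimensional ℝ E]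
    {M : Type*} [TopologicalSpace M] [T2Space M] [ConnectedSpace M]
    [ChartedSpace E M] [IsManifold 𝓘(ℝ, E) ∞ M]
    [RiemannianBundle (fun x : M ↦ TangentSpace 𝓘(ℝ, E) x)]
    [IsContMDiffRiemannianBundle 𝓘(ℝ, E) ∞ E (fun x : M ↦ TangentSpace 𝓘(ℝ, E) x)]
    (β : Π x : M, TangentSpace 𝓘(ℝ, E) x →L[ℝ] ℝ)
    (hβ : ContMDiff 𝓘(ℝ, E) (𝓘(ℝ, E).prod 𝓘(ℝ, E →L[ℝ] ℝ)) ∞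
      (fun x : M ↦ TotalSpace.mk' (E →L[ℝ] ℝ)
        (E := fun x : M ↦ (TangentSpace 𝓘(ℝ, E) x →L[ℝ] ℝ)) x (β x))) :
    ((∀ X : Π x : M, TangentSpace 𝓘(ℝ, E) x, CMDiff ∞ (T% X) →
        ∀ p : M, ∃ A, RiemannianOpt.IsSolutionAt β p (X p) A) ↔
      ∃ K : ℝ, ∀ p : M, ‖RiemannianOpt.sharp (β p)‖ = K) ∧
    ((∃ nabla : CovariantDerivative 𝓘(ℝ, E) E (fun x : M ↦ TangentSpace 𝓘(ℝ, E) x),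
        nabla.ContMDiffCovariantDerivative ∞ ∧
        ∀ X : Π x : M, TangentSpace 𝓘(ℝ, E) x, CMDiff ∞ (T% X) →
          ∀ p : M, RiemannianOpt.IsSolutionAt β p (X p) (RiemannianOpt.differenceTensor nabla p)) ↔
      ∃ K : ℝ, ∀ p : M, ‖RiemannianOpt.sharp (β p)‖ = K) := by
  have hsharp : CMDiff ∞ (T% (fun x ↦ RiemannianOpt.sharp (β x))) :=
    fun x ↦ RiemannianOpt.contMDiffAt_sharp (hβ x)
  have hmdiff (p : M) : MDiffAt (T% (fun x ↦ RiemannianOpt.sharp (β x))) p :=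
    (hsharp p).mdifferentiableAt (by simp)
  have necessary (h : ∀ X : Π x : M, TangentSpace 𝓘(ℝ, E) x, CMDiff ∞ (T% X) →
      ∀ p : M, ∃ A, RiemannianOpt.IsSolutionAt β p (X p) A) :
      ∃ K : ℝ, ∀ p : M, ‖RiemannianOpt.sharp (β p)‖ = K := by
    obtain ⟨p₀⟩ := (inferInstance : Nonempty M)
    refine ⟨‖RiemannianOpt.sharp (β p₀)‖, fun p ↦ ?_⟩
    have hconst := RiemannianOpt.eq_of_mvfderiv_eq_zero
      (f := fun x ↦ (inner ℝ (RiemannianOpt.sharp (β x)) (RiemannianOpt.sharp (β x)) : ℝ))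
      (fun x ↦ RiemannianOpt.mdifferentiableAt_inner (hmdiff x) (hmdiff x)) (fun x ↦ by
        ext v
        -- The hypothesis speaks of global smooth fields, so the tangent vector `v` is first
        -- extended to one.
        obtain ⟨X, hX, rfl⟩ := RiemannianOpt.exists_contMDiff_apply_eq x v
        obtain ⟨A, hA⟩ := h X hX x
        rw [RiemannianOpt.mvfderiv_inner_self (hmdiff x), hA.1.inner_leviCivita_eq_zero]
        simp) p p₀
    simp only [real_inner_self_eq_norm_sq] at hconst
    exact (pow_left_inj₀ (norm_nonneg _) (norm_nonneg _) two_ne_zero).1 hconst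
  refine ⟨⟨necessary, fun ⟨K, hK⟩ X _ p ↦
    ⟨_, RiemannianOpt.isSolutionAt_optimalTensor hK (hmdiff p) (X p)⟩⟩,
    fun ⟨nabla, _, h⟩ ↦ necessary fun X hX p ↦ ⟨_, h X hX p⟩, fun ⟨K, hK⟩ ↦
    ⟨RiemannianOpt.optimalConnection fun x ↦ RiemannianOpt.sharp (β x),
      RiemannianOpt.contMDiffCovariantDerivative_optimalConnection hsharp hK, fun X _ p ↦ ?_⟩⟩
  rw [RiemannianOpt.differenceTensor_optimalConnection]
  exact RiemannianOpt.isSolutionAt_optimalTensor hK (hmdiff p) (X p)
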